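/- Consider $n$ asynchronous deterministic processes, each with its own identifier and code, communicating only through shared multi-reader multi-writer registers, where a step of a process is the invocation of its method call or one atomic read or write of one register, together with the local computation that follows. In one-shot renaming each process invokes $\mathrm{getName}$ at most once. A one-shot renaming algorithm is $f$-adaptive if in no reachable configuration two distinct processes have been returned the same name, and if every name returned to a process $p$ lies in $\{1,\dots,f(k)\}$, where $k$ is the number of processes that have started $\mathrm{getName}$ by the time $p$'s $\mathrm{getName}$ completes. It is wait-free if, from every reachable configuration, every process completes its $\mathrm{getName}$ within a finite number of its own steps, regardless of the steps taken by the other processes. A register is bounded if only finitely many values can be stored in it. **Corollary.** For every $n$ there is a wait-free one-shot $\frac{3k^2}{2}$-adaptive renaming algorithm for $n$ processes (that is, every returned name $x$ satisfies $1\le x\le \frac{3k^2}{2}$ with $k$ as above) implemented from $\lceil\sqrt n\,\rceil+1$ bounded registers. -/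

import Mathlib

namespace Renaming

/-- The result of the local computation that follows an invocation or a shared memory access:
either the process continues with a new local state (in which it is poised to perform its next
shared memory access), or its `getName` method call completes and returns a name. -/
inductive Outcome (S : Type) : Type
  | continue (s : S)
  | complete (name : ℕ)

/-- A pending atomic access to one of `m` shared multi-reader multi-writer registers with values
in `V`, with the outcome of the local computation that follows it (for a read, as a function of
the value that is read). -/
inductive Access (m : ℕ) (V S : Type) : Type
  | read (r : Fin m) (next : V → Outcome S)
  | write (r : Fin m) (v : V) (next : Outcome S)

/-- A deterministic implementation of the method `getName` for `n` asynchronous processes that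
communicate through `m` shared registers. Each process has its own code. -/
structure Algorithm (n m : ℕ) where
  /-- values that can be stored in a register -/
  Value : Type
  /-- local states in which a process is poised to access a register -/
  State : Type
  /-- initial contents of the registers -/
  initValue : Fin m → Value
  /-- the local computation triggered by the invocation of `getName` -/
  invoke : Fin n → Outcome State
  /-- the shared memory access that a process is poised to perform -/
  access : Fin n → State → Access m Value State

/-- The state of a process in one-shot renaming: it has not yet invoked `getName`, it is
executing `getName`, or its only `getName` has completed and it owns the name returned. -/
inductive ProcState (S : Type) : Type
  | idle
  | running (s : S)
  | named (name : ℕ)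

/-- The process state resulting from an outcome. -/
def Outcome.toProcState {S : Type} : Outcome S → ProcState S
  | .continue s => .running s
  | .complete x => .named x

namespace Algorithm

variable {n m : ℕ}

/-- A configuration: the state of every process and the value of every register. -/
structure Config (A : Algorithm n m) where
  proc : Fin n → ProcState A.State
  reg : Fin m → A.Value

/-- The initial configuration: every process is about to invoke `getName`. -/
def initial (A : Algorithm n m) : A.Config where
  proc := fun _ => .idle
  reg := A.initValue

/-- The configuration after a step by process `p`: the invocation of `getName` or one atomic
register access, followed by all local operations up to the next register access or the
completion of the method call. In one-shot renaming a process whose `getName` is completed does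
nothing any more. -/
def step (A : Algorithm n m) (C : A.Config) (p : Fin n) : A.Config :=
  match C.proc p with
  | .idle =>
      { proc := Function.update C.proc p (A.invoke p).toProcState
        reg := C.reg }
  | .running s =>
      match A.access p s with
      | .read r next =>
          { proc := Function.update C.proc p (next (C.reg r)).toProcState
            reg := C.reg }
      | .write r v next =>
          { proc := Function.update C.proc p next.toProcState
            reg := Function.update C.reg r v }
  | .named _ => C

/-- The configuration reached from `C` by a finite schedule, a finite sequence of process
identifiers. -/
def run (A : Algorithm n m) (C : A.Config) (σ : List (Fin n)) : A.Config :=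
  σ.foldl A.step C

/-- `C` is reachable from the initial configuration by a finite schedule. -/
def Reachable (A : Algorithm n m) (C : A.Config) : Prop :=
  ∃ σ : List (Fin n), A.run A.initial σ = C

/-- Process `p` has completed a `getName` that returned the name `x`. -/
def Owns (A : Algorithm n m) (C : A.Config) (p : Fin n) (x : ℕ) : Prop :=
  C.proc p = .named x

/-- The number of participants in `C`, that is, of processes that have started a `getName`
(in the one-shot version names are never released). -/
noncomputable def participants (A : Algorithm n m) (C : A.Config) : ℕ :=
  {p : Fin n | C.proc p ≠ .idle}.ncard

/-- The registers are bounded: only finitely many values can be stored in them. -/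
def BoundedRegisters (A : Algorithm n m) : Prop :=
  Finite A.Value

/-- Wait-freedom: from every reachable configuration every process completes its method call in
a finite number `N` of its own steps, regardless of the steps taken by other processes. -/
def WaitFree (A : Algorithm n m) : Prop :=
  ∀ C : A.Config, A.Reachable C → ∀ p : Fin n, ∃ N : ℕ,
    ∀ σ : List (Fin n), N ≤ σ.count p → ∃ x : ℕ, A.Owns (A.run C σ) p x

/-- Safety of one-shot `b`-bounded `f`-adaptive renaming. No two processes own the same name in a
reachable configuration; and whenever the `getName` of a process `p` completes, in a step of `p`
from a reachable configuration `C`, and the number `k` of processes that have started a `getName`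
by then is at most `b`, the returned name `x` satisfies `1 ≤ x ≤ f k`. -/
def IsBoundedAdaptiveRenaming (A : Algorithm n m) (b : ℕ) (f : ℕ → ℝ) : Prop :=
  (∀ C : A.Config, A.Reachable C → ∀ (p q : Fin n) (x : ℕ),
      A.Owns C p x → A.Owns C q x → p = q) ∧
  (∀ C : A.Config, A.Reachable C → ∀ (p : Fin n) (x : ℕ),
      (∀ y : ℕ, ¬ A.Owns C p y) → A.Owns (A.step C p) p x →
      A.participants (A.step C p) ≤ b →
        1 ≤ x ∧ (x : ℝ) ≤ f (A.participants (A.step C p)))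

/-- One-shot `f`-adaptive renaming is one-shot `n`-bounded `f`-adaptive renaming. -/
def IsAdaptiveRenaming (A : Algorithm n m) (f : ℕ → ℝ) : Prop :=
  A.IsBoundedAdaptiveRenaming n f

end Algorithm

end Renaming

namespace Renaming

/-! ### The view algorithm and its transition relation -/

variable {n b : ℕ}

/-! Let `b = ⌈√n⌉`. Each process keeps a growing view `S`, the participants it knows of. It scans
all `b + 1` registers and merges what it reads. If `S` then has more than `b` elements, it takes a
backup name given by its identifier. Otherwise it writes `S` to one of the registers `0, …, |S|`
that did not hold `S`, and scans again; if all of them held `S`, it rereads every register, and if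
nothing has changed it takes its rank in `S`, shifted by `|S|.choose 2`.

Safety: tags are unique, so a successful reread means that the registers `0, …, |S|` all held `S` at
one instant. After that, no other view `T` of the same size can do the same (`Move.locked`). Indeed
a process that writes a subset of `T` lies in `T`, and before its next write it reads a register not
yet overwritten in this way, so that its view leaves `T`. Each element of `T` thus accounts for at
most one overwritten register, and `|T| + 1` would be needed. So there is one successful view per
size; sizes give disjoint blocks of names, and ranks separate names within a block.

Termination: in an infinite execution the views become constant. A process with a smallest view
among those that move forever reads only subsets of its view, hence exactly its view in every
register that is still being written, and stops writing. Once all such processes are silent, the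
registers they can read without enlarging their views no longer change, and their rereads succeed
(`Loop.false`).

Boundedness: without infinite executions, finite branching leaves only finitely many reachable
configurations, so the sequence numbers in the tags take finitely many values. -/

/-- The contents of a register: a set of processes, and a tag (writer and sequence number) that
makes every write unique. -/
structure Cell (n : ℕ) where
  view : Finset (Fin n)
  tag : Option (Fin n × ℕ)

/-- What a process does next: write its view to a register, scan the registers, or check that
nothing has changed since the last scan. -/
inductive Phase (b : ℕ) : Type
  | write (i : Fin (b + 1))
  | scan (j : Fin (b + 1))
  | check (j : Fin (b + 1))

/-- Local states: the processes seen so far, the number of writes performed, the last scan, and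
the current phase. -/
structure LocalState (n b : ℕ) where
  view : Finset (Fin n)
  ctr : ℕ
  log : Fin (b + 1) → Cell n
  phase : Phase b

/-- The name of the process `p` that returns with the view `S`. -/
def nameIn (S : Finset (Fin n)) (p : Fin n) : ℕ :=
  S.card.choose 2 + (S.filter (· ≤ p)).card

/-- The name of the process `p` if it has seen more than `b` participants. -/
def backupName (b : ℕ) (p : Fin n) : ℕ :=
  (b + 1).choose 2 + p + 1

/-- The state of `s` after reading `v` from register `j` during a scan. -/
def LocalState.absorb (s : LocalState n b) (j : Fin (b + 1)) (v : Cell n) (ph : Phase b) :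
    LocalState n b where
  view := s.view ∪ v.view
  ctr := s.ctr
  log := Function.update s.log j v
  phase := ph

/-- The initial local state. -/
def LocalState.start (p : Fin n) : LocalState n b where
  view := {p}
  ctr := 0
  log := fun _ => ⟨∅, none⟩
  phase := .scan 0

/-- A register that is required to contain the view `S`, but did not during the scan. -/
def Outdated (S : Finset (Fin n)) (log : Fin (b + 1) → Cell n) (i : Fin (b + 1)) : Prop :=
  (i : ℕ) ≤ S.card ∧ (log i).view ≠ S

open Classical in
/-- The local computation after a read during a scan. -/
noncomputable def scanOutcome (p : Fin n) (s : LocalState n b) (j : Fin (b + 1)) (v : Cell n) :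
    Outcome (LocalState n b) :=
  if j ≠ Fin.last b then .continue (s.absorb j v (.scan (j + 1)))
  else if b < (s.view ∪ v.view).card then .complete (backupName b p)
  else if h : ∃ i, Outdated (s.view ∪ v.view) (Function.update s.log j v) i then
    .continue (s.absorb j v (.write h.choose))
  else .continue (s.absorb j v (.check 0))

open Classical in
/-- The local computation after a read during a check. -/
noncomputable def checkOutcome (p : Fin n) (s : LocalState n b) (j : Fin (b + 1)) (v : Cell n) :
    Outcome (LocalState n b) :=
  if v ≠ s.log j then .continue (s.absorb j v (.scan 0))
  else if j ≠ Fin.last b then .continue { s with phase := .check (j + 1) }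
  else .complete (nameIn s.view p)

/-- The adaptive renaming algorithm from `b + 1` (unbounded) registers. -/
noncomputable def viewAlgorithm (n b : ℕ) : Algorithm n (b + 1) where
  Value := Cell n
  State := LocalState n b
  initValue := fun _ => ⟨∅, none⟩
  invoke := fun p => .continue (.start p)
  access := fun p s =>
    match s.phase with
    | .write i => .write i ⟨s.view, some (p, s.ctr)⟩
        (.continue { s with ctr := s.ctr + 1, phase := .scan 0 })
    | .scan j => .read j (scanOutcome p s j)
    | .check j => .read j (checkOutcome p s j)

/-- Configurations of the algorithm, with the types of values and local states made explicit. -/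
structure Conf (n b : ℕ) where
  proc : Fin n → ProcState (LocalState n b)
  reg : Fin (b + 1) → Cell n

/-- A configuration of the algorithm as a `Conf`. -/
def toConf (C : (viewAlgorithm n b).Config) : Conf n b := ⟨C.proc, C.reg⟩

/-- The effect of the steps of processes that are not yet named. -/
inductive Move (C : Conf n b) (p : Fin n) : Conf n b → Prop
  | start (h : C.proc p = .idle) :
      Move C p ⟨Function.update C.proc p (.running (.start p)), C.reg⟩
  | write (s : LocalState n b) (i : Fin (b + 1)) (h : C.proc p = .running s)
      (hs : s.phase = .write i) :
      Move C p ⟨Function.update C.proc p (.running { s with ctr := s.ctr + 1, phase := .scan 0 }),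
        Function.update C.reg i ⟨s.view, some (p, s.ctr)⟩⟩
  | scanNext (s : LocalState n b) (j : Fin (b + 1)) (h : C.proc p = .running s)
      (hs : s.phase = .scan j) (hj : j ≠ Fin.last b) :
      Move C p ⟨Function.update C.proc p (.running (s.absorb j (C.reg j) (.scan (j + 1)))), C.reg⟩
  | scanFull (s : LocalState n b) (h : C.proc p = .running s)
      (hs : s.phase = .scan (Fin.last b)) (hb : b < (s.view ∪ (C.reg (Fin.last b)).view).card) :
      Move C p ⟨Function.update C.proc p (.named (backupName b p)), C.reg⟩
  | scanWrite (s : LocalState n b) (i : Fin (b + 1)) (h : C.proc p = .running s)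
      (hs : s.phase = .scan (Fin.last b))
      (hi : Outdated (s.view ∪ (C.reg (Fin.last b)).view)
        (Function.update s.log (Fin.last b) (C.reg (Fin.last b))) i) :
      Move C p ⟨Function.update C.proc p
        (.running (s.absorb (Fin.last b) (C.reg (Fin.last b)) (.write i))), C.reg⟩
  | scanCheck (s : LocalState n b) (h : C.proc p = .running s)
      (hs : s.phase = .scan (Fin.last b)) (hb : (s.view ∪ (C.reg (Fin.last b)).view).card ≤ b)
      (hi : ∀ i, ¬ Outdated (s.view ∪ (C.reg (Fin.last b)).view)
        (Function.update s.log (Fin.last b) (C.reg (Fin.last b))) i) :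
      Move C p ⟨Function.update C.proc p
        (.running (s.absorb (Fin.last b) (C.reg (Fin.last b)) (.check 0))), C.reg⟩
  | checkMiss (s : LocalState n b) (j : Fin (b + 1)) (h : C.proc p = .running s)
      (hs : s.phase = .check j) (hv : C.reg j ≠ s.log j) :
      Move C p ⟨Function.update C.proc p (.running (s.absorb j (C.reg j) (.scan 0))), C.reg⟩
  | checkNext (s : LocalState n b) (j : Fin (b + 1)) (h : C.proc p = .running s)
      (hs : s.phase = .check j) (hv : C.reg j = s.log j) (hj : j ≠ Fin.last b) :
      Move C p ⟨Function.update C.proc p (.running { s with phase := .check (j + 1) }), C.reg⟩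
  | checkDone (s : LocalState n b) (h : C.proc p = .running s)
      (hs : s.phase = .check (Fin.last b)) (hv : C.reg (Fin.last b) = s.log (Fin.last b)) :
      Move C p ⟨Function.update C.proc p (.named (nameIn s.view p)), C.reg⟩

theorem Algorithm.step_of_named {m : ℕ} (A : Algorithm n m) {C : A.Config} {p : Fin n} {x : ℕ}
    (h : C.proc p = .named x) : A.step C p = C := by
  simp [Algorithm.step, h]

/-- From here on the invariant and the termination argument see the algorithm only through the cases
of `Move`. -/
theorem move_step {C : (viewAlgorithm n b).Config} {p : Fin n}
    (hC : ∀ x, C.proc p ≠ .named x) :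
    Move (toConf C) p (toConf ((viewAlgorithm n b).step C p)) := by
  rcases hp : C.proc p with _ | s | x
  · have h1 : toConf ((viewAlgorithm n b).step C p) =
        ⟨Function.update (toConf C).proc p (.running (.start p)), (toConf C).reg⟩ := by
      simp only [Algorithm.step, hp]
      rfl
    rw [h1]
    exact .start hp
  · have h1 : toConf ((viewAlgorithm n b).step C p) = match s.phase with
        | .write i => ⟨Function.update (toConf C).proc p
            (.running { s with ctr := s.ctr + 1, phase := .scan 0 }),
            Function.update (toConf C).reg i ⟨s.view, some (p, s.ctr)⟩⟩
        | .scan j => ⟨Function.update (toConf C).proc p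
            (scanOutcome p s j ((toConf C).reg j)).toProcState, (toConf C).reg⟩
        | .check j => ⟨Function.update (toConf C).proc p
            (checkOutcome p s j ((toConf C).reg j)).toProcState, (toConf C).reg⟩ := by
      simp only [Algorithm.step, hp, viewAlgorithm]
      rcases s.phase with i | j | j <;> rfl
    rw [h1]
    replace hp : (toConf C).proc p = .running s := hp
    generalize toConf C = D at *
    rcases hs : s.phase with i | j | j
    · exact .write s i hp hs
    · dsimp only
      unfold scanOutcome
      split_ifs with h1 h2 h3
      · exact .scanNext s j hp hs h1
      · obtain rfl := not_not.1 h1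
        exact .scanFull s hp hs h2
      · obtain rfl := not_not.1 h1
        exact .scanWrite s _ hp hs h3.choose_spec
      · obtain rfl := not_not.1 h1
        exact .scanCheck s hp hs (not_lt.1 h2) (not_exists.1 h3)
    · dsimp only
      unfold checkOutcome
      split_ifs with h1 h2
      · exact .checkMiss s j hp hs h1
      · exact .checkNext s j hp hs (not_not.1 h1) h2
      · obtain rfl := not_not.1 h2
        exact .checkDone s hp hs (not_not.1 h1)
  · exact absurd hp (hC x)

/-! ### Tags are never reused -/

/-- The sequence numbers that a process has used. -/
def ProcState.Used : ProcState (LocalState n b) → ℕ → Prop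
  | .idle, _ => False
  | .running s, k => k < s.ctr
  | .named _, _ => True

/-- The value `v` will not be written any more. -/
def Stale (C : Conf n b) (v : Cell n) : Prop :=
  ∀ u k, v.tag = some (u, k) → (C.proc u).Used k

/-- A named process never writes again, so it may count as having used every number; this keeps
`Used` monotone. -/
theorem Move.used_mono {C C' : Conf n b} {p : Fin n} (h : Move C p C') (u : Fin n) (k : ℕ)
    (hk : (C.proc u).Used k) : (C'.proc u).Used k := by
  by_cases hu : u = p
  · subst hu
    cases h <;> simp_all [ProcState.Used, LocalState.absorb]; omega
  · cases h <;> simpa [Function.update_of_ne hu] using hk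

theorem Move.stale {C C' : Conf n b} {p : Fin n} (h : Move C p C') {v : Cell n}
    (hv : Stale C v) : Stale C' v :=
  fun u k hk => h.used_mono u k (hv u k hk)

/-! ### Locked views -/

/-- A process that cannot write a view contained in `T` before it has read a register outside
`E`, among the registers `0, …, c`. -/
def ProcState.Spent (E : Finset (Fin (b + 1))) (c : ℕ) (T : Finset (Fin n)) :
    ProcState (LocalState n b) → Prop
  | .idle => False
  | .running s => ¬ s.view ⊆ T ∨ ∃ j, s.phase = .scan j ∧ ∀ i < j, (i : ℕ) ≤ c → i ∈ E
  | .named _ => True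

/-- The registers `0, …, c` can never again all contain subsets of `T`. -/
def Locked (C : Conf n b) (c : ℕ) (T : Finset (Fin n)) : Prop :=
  ∃ E : Finset (Fin (b + 1)), ∃ U ⊆ T, E.card ≤ U.card ∧
    (∀ i : Fin (b + 1), (i : ℕ) ≤ c → i ∉ E → ¬ (C.reg i).view ⊆ T) ∧
    ∀ u ∈ U, (C.proc u).Spent E c T

/-- There are `c + 1` registers with index at most `c`, one more than `E` can cover. -/
theorem exists_le_notMem {E : Finset (Fin (b + 1))} {c : ℕ} (hc : c ≤ b) (hE : E.card ≤ c) :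
    ∃ i : Fin (b + 1), (i : ℕ) ≤ c ∧ i ∉ E := by
  by_contra! h
  have : (Finset.univ.map (Fin.castLEEmb (Nat.succ_le_succ hc))).card ≤ E.card := by
    apply Finset.card_le_card
    intro i hi
    obtain ⟨a, -, rfl⟩ := Finset.mem_map.1 hi
    exact h _ (Nat.lt_succ_iff.1 a.2)
  simp at this
  omega

theorem Locked.exists_reg {C : Conf n b} {c : ℕ} {T : Finset (Fin n)} (h : Locked C c T)
    (hc : c ≤ b) (hT : T.card ≤ c) :
    ∃ i : Fin (b + 1), (i : ℕ) ≤ c ∧ ¬ (C.reg i).view ⊆ T := by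
  obtain ⟨E, U, hU, hE, hr, -⟩ := h
  obtain ⟨i, hi, hiE⟩ := exists_le_notMem hc (hE.trans ((Finset.card_le_card hU).trans hT))
  exact ⟨i, hi, hr i hi hiE⟩

theorem fin_lt_or_eq_of_lt_add_one {i j : Fin (b + 1)} (hj : j ≠ Fin.last b) (h : i < j + 1) :
    i < j ∨ i = j := by
  have hj' : (j : ℕ) < b := Fin.val_lt_last hj
  have h1 : ((j + 1 : Fin (b + 1)) : ℕ) = j + 1 := Fin.val_add_one_of_lt hj'
  rw [Fin.lt_def, h1] at h
  rw [Fin.lt_def, Fin.ext_iff]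
  omega

/-- `E` collects the registers overwritten by subsets of `T`, and `U` the processes charged for
these writes, each at most once. -/
theorem Move.locked {C C' : Conf n b} {p : Fin n} (h : Move C p C')
    (hp : ∀ s, C.proc p = .running s → p ∈ s.view) {c : ℕ} {T : Finset (Fin n)}
    (hc : c ≤ b) (hT : T.card ≤ c) (hl : Locked C c T) : Locked C' c T := by
  obtain ⟨E, U, hU, hE, hr, hs⟩ := hl
  have hEc : E.card ≤ c := hE.trans ((Finset.card_le_card hU).trans hT)
  have same : ∀ X : ProcState (LocalState n b), (p ∈ U → X.Spent E c T) →
      Locked (⟨Function.update C.proc p X, C.reg⟩ : Conf n b) c T := by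
    intro X hX
    refine ⟨E, U, hU, hE, hr, fun u hu => ?_⟩
    by_cases hup : u = p
    · subst hup
      simpa using hX hu
    · simpa [Function.update_of_ne hup] using hs u hu
  -- A spent process that completes a scan has read a register outside `E`, so its view has left
  -- `T`.
  have full : ∀ s : LocalState n b, C.proc p = .running s → s.phase = .scan (Fin.last b) →
      p ∈ U → ¬ s.view ∪ (C.reg (Fin.last b)).view ⊆ T := by
    intro s h1 h2 hpU hsub
    have h3 := hs p hpU
    rw [h1] at h3
    rcases h3 with h3 | ⟨j, hj, h3⟩
    · exact h3 (Finset.union_subset_left hsub)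
    · rw [h2] at hj
      cases hj
      obtain ⟨i, hi, hiE⟩ := exists_le_notMem hc hEc
      rcases (Fin.le_last i).lt_or_eq with h4 | h4
      · exact hiE (h3 i h4 hi)
      · subst h4
        exact hr _ hi hiE (Finset.union_subset_right hsub)
  cases h with
  | start h => exact same _ fun hpU => by simpa [h, ProcState.Spent] using hs p hpU
  | write s i h hph =>
    by_cases hv : s.view ⊆ T
    -- A spent process that is about to write has a view outside `T`; hence `p` has not been charged
    -- before. It lies in `T` because it lies in its own view.
    · have hpU : p ∉ U := fun hpU => by
        simpa [h, ProcState.Spent, hv, hph] using hs p hpU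
      refine ⟨insert i E, insert p U, Finset.insert_subset (hv (hp s h)) hU, ?_, ?_, ?_⟩
      · rw [Finset.card_insert_of_notMem hpU]
        exact (Finset.card_insert_le _ _).trans (by omega)
      · intro k hk hkE
        rw [Finset.mem_insert, not_or] at hkE
        simpa [Function.update_of_ne hkE.1] using hr k hk hkE.2
      · intro u hu
        by_cases hup : u = p
        · subst hup
          -- The new scan starts at `0`, so no register has been read yet and the condition on `i <
          -- j` is vacuous.
          simp [ProcState.Spent]
        · have h1 := hs u ((Finset.mem_insert.1 hu).resolve_left hup)
          simp only [Function.update_of_ne hup]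
          revert h1
          rcases C.proc u with _ | t | x
          · exact id
          · rintro (h1 | ⟨j, hj, h1⟩)
            · exact .inl h1
            · exact .inr ⟨j, hj, fun k hk hkc => Finset.mem_insert_of_mem (h1 k hk hkc)⟩
          · exact id
    · refine ⟨E, U, hU, hE, fun k hk hkE => ?_, fun u hu => ?_⟩
      · by_cases hki : k = i
        · subst hki
          simpa using hv
        · simpa [Function.update_of_ne hki] using hr k hk hkE
      · by_cases hup : u = p
        · subst hup
          simp [ProcState.Spent, hv]
        · simpa [Function.update_of_ne hup] using hs u hu
  | scanNext s j h hph hj =>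
    refine same _ fun hpU => ?_
    have h1 := hs p hpU
    rw [h] at h1
    rcases h1 with h1 | ⟨j', hj', h1⟩
    · exact .inl fun h2 => h1 (Finset.union_subset_left h2)
    · rw [hph] at hj'
      cases hj'
      by_cases hv : (C.reg j).view ⊆ T
      · refine .inr ⟨j + 1, rfl, fun i hi hic => ?_⟩
        rcases fin_lt_or_eq_of_lt_add_one hj hi with h2 | rfl
        · exact h1 i h2 hic
        · by_contra h3
          exact hr i hic h3 hv
      · exact .inl fun h2 => hv (Finset.union_subset_right h2)
  | scanFull s h hph hb => exact same _ fun _ => trivial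
  | scanWrite s i h hph hi => exact same _ fun hpU => .inl (full s h hph hpU)
  | scanCheck s h hph hb hi => exact same _ fun hpU => .inl (full s h hph hpU)
  | checkMiss s j h hph hv =>
    refine same _ fun hpU => ?_
    have h1 := hs p hpU
    rw [h] at h1
    rcases h1 with h1 | ⟨j', hj', -⟩
    · exact .inl fun h2 => h1 (Finset.union_subset_left h2)
    · rw [hph] at hj'
      cases hj'
  | checkNext s j h hph hv hj =>
    refine same _ fun hpU => ?_
    have h1 := hs p hpU
    rw [h] at h1
    rcases h1 with h1 | ⟨j', hj', -⟩
    · exact .inl h1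
    · rw [hph] at hj'
      cases hj'
  | checkDone s h hph hv => exact same _ fun _ => trivial

/-! ### The invariant -/

/-- The processes that have started. -/
def started (C : Conf n b) : Set (Fin n) := {p | C.proc p ≠ .idle}

/-- A process that checks has found its view in all required registers, and either will find a
difference or its view is in `L`. -/
def CheckOK (C : Conf n b) (L : Set (Finset (Fin n))) (s : LocalState n b) (j : Fin (b + 1)) :
    Prop :=
  s.view.card ≤ b ∧ (∀ i : Fin (b + 1), (i : ℕ) ≤ s.view.card → (s.log i).view = s.view) ∧
    ((∃ i ≥ j, C.reg i ≠ s.log i) ∨ s.view ∈ L)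

/-- A name is justified by a locked view or by more than `b` participants. -/
def NameOK (C : Conf n b) (L : Set (Finset (Fin n))) (p : Fin n) (x : ℕ) : Prop :=
  (∃ S ∈ L, p ∈ S ∧ (S : Set (Fin n)) ⊆ started C ∧ x = nameIn S p) ∨
    (b < (started C).ncard ∧ x = backupName b p)

/-- The inductive invariant; `L` is the set of views that have been in all required registers
simultaneously. -/
structure Inv (C : Conf n b) (L : Set (Finset (Fin n))) : Prop where
  reg_subset : ∀ i, ((C.reg i).view : Set (Fin n)) ⊆ started C
  reg_stale : ∀ i, Stale C (C.reg i)
  mem_view : ∀ p s, C.proc p = .running s → p ∈ s.view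
  view_subset : ∀ p s, C.proc p = .running s → (s.view : Set (Fin n)) ⊆ started C
  log_stale : ∀ p s, C.proc p = .running s → ∀ i, Stale C (s.log i)
  check : ∀ p s j, C.proc p = .running s → s.phase = .check j → CheckOK C L s j
  name : ∀ p x, C.proc p = .named x → NameOK C L p x
  card_le : ∀ S ∈ L, S.card ≤ b
  locked : ∀ S ∈ L, ∀ T : Finset (Fin n), T.card ≤ S.card → ¬ S ⊆ T → Locked C S.card T
  unique : ∀ S ∈ L, ∀ T ∈ L, S.card = T.card → S = T

theorem inv_initial : Inv (toConf (viewAlgorithm n b).initial) ∅ where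
  reg_subset := fun i => by simp [toConf, Algorithm.initial, viewAlgorithm]
  reg_stale := fun i u k h => by simp [toConf, Algorithm.initial, viewAlgorithm] at h
  mem_view := fun p s h => by simp [toConf, Algorithm.initial] at h
  view_subset := fun p s h => by simp [toConf, Algorithm.initial] at h
  log_stale := fun p s h => by simp [toConf, Algorithm.initial] at h
  check := fun p s j h => by simp [toConf, Algorithm.initial] at h
  name := fun p s h => by simp [toConf, Algorithm.initial] at h
  card_le := by simp
  locked := by simp
  unique := by simp

theorem Move.started_mono {C C' : Conf n b} {p : Fin n} (h : Move C p C') :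
    started C ⊆ started C' := by
  intro u hu
  simp only [started, Set.mem_ofPred_eq] at hu ⊢
  by_cases hup : u = p
  · subst hup
    cases h <;> simp
  · cases h <;> simpa [Function.update_of_ne hup] using hu

theorem Move.mem_started {C C' : Conf n b} {p : Fin n} (h : Move C p C') : p ∈ started C' := by
  simp only [started, Set.mem_ofPred_eq]
  cases h <;> simp

theorem NameOK.mono {C C' : Conf n b} {L L' : Set (Finset (Fin n))} {p : Fin n} {x : ℕ}
    (h : NameOK C L p x) (hC : started C ⊆ started C') (hL : L ⊆ L') : NameOK C' L' p x := by
  rcases h with ⟨S, hS, hp, hs, hx⟩ | ⟨hb, hx⟩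
  · exact .inl ⟨S, hL hS, hp, hs.trans hC, hx⟩
  · exact .inr ⟨hb.trans_le (Set.ncard_le_ncard hC (Set.toFinite _)), hx⟩

/-- A value that has disappeared from a register does not come back. -/
theorem Move.reg_ne {C C' : Conf n b} {p : Fin n} (h : Move C p C') {v : Cell n}
    (hv : Stale C v) {i : Fin (b + 1)} (hi : C.reg i ≠ v) : C'.reg i ≠ v := by
  cases h with
  | write s k h hph =>
    by_cases hik : i = k
    · subst hik
      rintro rfl
      -- The tag just written carries the number `s.ctr`, which was not yet used.
      have := hv p s.ctr (by simp)
      simp [h, ProcState.Used] at this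
    · simpa [Function.update_of_ne hik] using hi
  | _ => exact hi

theorem Move.proc_of_ne {C C' : Conf n b} {p u : Fin n} (h : Move C p C') (hu : u ≠ p) :
    C'.proc u = C.proc u := by
  cases h <;> simp [Function.update_of_ne hu]

theorem Move.reg_cases {C C' : Conf n b} {p : Fin n} (h : Move C p C') (i : Fin (b + 1)) :
    C'.reg i = C.reg i ∨ ∃ s : LocalState n b, C.proc p = .running s ∧ s.phase = .write i ∧
      C'.reg i = ⟨s.view, some (p, s.ctr)⟩ := by
  cases h with
  | write s k h hph =>
    by_cases hik : i = k
    · subst hik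
      exact .inr ⟨s, h, hph, by simp⟩
    · exact .inl (by simp [Function.update_of_ne hik])
  | _ => exact .inl rfl

/-- The new view of a process that takes a step. -/
theorem Move.view_cases {C C' : Conf n b} {p : Fin n} (h : Move C p C') {s' : LocalState n b}
    (hs' : C'.proc p = .running s') :
    (C.proc p = .idle ∧ s' = .start p) ∨ ∃ s, C.proc p = .running s ∧
      (s'.view = s.view ∨ ∃ j, s'.view = s.view ∪ (C.reg j).view) ∧
      (∀ i, s'.log i = s.log i ∨ s'.log i = C.reg i) := by
  have upd : ∀ (f : Fin (b + 1) → Cell n) (j i : Fin (b + 1)),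
      Function.update f j (C.reg j) i = f i ∨ Function.update f j (C.reg j) i = C.reg i := by
    intro f j i
    by_cases hij : i = j
    · subst hij
      simp
    · simp [Function.update_of_ne hij]
  cases h <;> simp only [Function.update_self, ProcState.running.injEq, reduceCtorEq] at hs' <;>
    subst hs'
  case start h => exact .inl ⟨h, rfl⟩
  case write s i h hph => exact .inr ⟨s, h, .inl rfl, fun i => .inl rfl⟩
  case checkNext s j h hph hv hj => exact .inr ⟨s, h, .inl rfl, fun i => .inl rfl⟩
  all_goals exact .inr ⟨_, ‹_›, .inr ⟨_, rfl⟩, upd _ _⟩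

/-- Every step preserves the invariant, possibly with one more locked view. -/
theorem Move.exists_inv {C C' : Conf n b} {p : Fin n} {L : Set (Finset (Fin n))}
    (h : Move C p C') (hI : Inv C L) : ∃ L', Inv C' L' := by
  have hst := h.started_mono
  have reg_stale : ∀ i, Stale C' (C'.reg i) := by
    intro i
    cases h with
    | write s k hp hph =>
      by_cases hik : i = k
      · subst hik
        intro u l hl
        simp only [Function.update_self, Option.some.injEq, Prod.mk.injEq] at hl
        obtain ⟨rfl, rfl⟩ := hl
        simp [ProcState.Used]
      · simp only [Function.update_of_ne hik]
        exact (Move.write s k hp hph).stale (hI.reg_stale i)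
    | _ => exact Move.stale (by constructor <;> assumption) (hI.reg_stale i)
  have reg_subset : ∀ i, ((C'.reg i).view : Set (Fin n)) ⊆ started C' := by
    intro i
    rcases h.reg_cases i with h1 | ⟨s, h1, -, h2⟩
    · rw [h1]
      exact (hI.reg_subset i).trans hst
    · rw [h2]
      exact (hI.view_subset p s h1).trans hst
  have mem_view : ∀ q s, C'.proc q = .running s → q ∈ s.view := by
    intro q s hq
    by_cases hqp : q = p
    · subst hqp
      rcases h.view_cases hq with ⟨-, rfl⟩ | ⟨t, ht, h1 | ⟨j, h1⟩, -⟩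
      · simp [LocalState.start]
      · rw [h1]
        exact hI.mem_view q t ht
      · rw [h1]
        exact Finset.mem_union_left _ (hI.mem_view q t ht)
    · rw [h.proc_of_ne hqp] at hq
      exact hI.mem_view q s hq
  have view_subset : ∀ q s, C'.proc q = .running s → (s.view : Set (Fin n)) ⊆ started C' := by
    intro q s hq
    by_cases hqp : q = p
    · subst hqp
      rcases h.view_cases hq with ⟨-, rfl⟩ | ⟨t, ht, h1 | ⟨j, h1⟩, -⟩
      · simpa [LocalState.start] using h.mem_started
      · rw [h1]
        exact (hI.view_subset q t ht).trans hst
      · rw [h1, Finset.coe_union]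
        exact Set.union_subset ((hI.view_subset q t ht).trans hst) ((hI.reg_subset j).trans hst)
    · rw [h.proc_of_ne hqp] at hq
      exact (hI.view_subset q s hq).trans hst
  have log_stale : ∀ q s, C'.proc q = .running s → ∀ i, Stale C' (s.log i) := by
    intro q s hq i
    by_cases hqp : q = p
    · subst hqp
      rcases h.view_cases hq with ⟨-, rfl⟩ | ⟨t, ht, -, h1⟩
      · intro u k hk
        simp [LocalState.start] at hk
      · rcases h1 i with h1 | h1 <;> rw [h1]
        · exact h.stale (hI.log_stale q t ht i)
        · exact h.stale (hI.reg_stale i)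
    · rw [h.proc_of_ne hqp] at hq
      exact h.stale (hI.log_stale q s hq i)
  have locked : ∀ S ∈ L, ∀ T : Finset (Fin n), T.card ≤ S.card → ¬ S ⊆ T →
      Locked C' S.card T := fun S hS T hT hST =>
    h.locked (hI.mem_view p) (hI.card_le S hS) hT (hI.locked S hS T hT hST)
  have check_ne : ∀ q, q ≠ p → ∀ s j, C'.proc q = .running s → s.phase = .check j →
      CheckOK C' L s j := by
    intro q hqp s j hq hs
    rw [h.proc_of_ne hqp] at hq
    obtain ⟨h1, h2, h3⟩ := hI.check q s j hq hs
    refine ⟨h1, h2, h3.imp_left ?_⟩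
    rintro ⟨i, hi, h3⟩
    exact ⟨i, hi, h.reg_ne (hI.log_stale q s hq i) h3⟩
  have name_ne : ∀ q, q ≠ p → ∀ x, C'.proc q = .named x → NameOK C' L q x := by
    intro q hqp x hq
    rw [h.proc_of_ne hqp] at hq
    exact (hI.name q x hq).mono hst subset_rfl
  have keep : (∀ s j, C'.proc p = .running s → s.phase = .check j → CheckOK C' L s j) →
      (∀ x, C'.proc p = .named x → NameOK C' L p x) → ∃ L', Inv C' L' := by
    intro h1 h2
    refine ⟨L, reg_subset, reg_stale, mem_view, view_subset, log_stale, ?_, ?_, hI.card_le,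
      locked, hI.unique⟩
    · intro q s j hq
      by_cases hqp : q = p
      · subst hqp
        exact h1 s j hq
      · exact check_ne q hqp s j hq
    · intro q x hq
      by_cases hqp : q = p
      · subst hqp
        exact h2 x hq
      · exact name_ne q hqp x hq
  have quiet : ∀ t, C'.proc p = .running t → (∀ j, t.phase ≠ .check j) → ∃ L', Inv C' L' := by
    intro t ht hne
    refine keep (fun s j hs hj => ?_) (fun x hx => ?_)
    · rw [ht] at hs
      cases hs
      exact absurd hj (hne j)
    · simp [ht] at hx
  cases h with
  | start h => exact quiet _ (Function.update_self ..) (by simp [LocalState.start])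
  | write s i h hph => exact quiet _ (Function.update_self ..) (by simp)
  | scanNext s j h hph hj => exact quiet _ (Function.update_self ..) (by simp [LocalState.absorb])
  | scanFull s h hph hb =>
    refine keep (by simp) fun x hx => ?_
    simp only [Function.update_self, ProcState.named.injEq] at hx
    refine .inr ⟨hb.trans_le ?_, hx.symm⟩
    rw [← Set.ncard_coe_finset, Finset.coe_union]
    exact Set.ncard_le_ncard (Set.union_subset ((hI.view_subset p s h).trans hst)
      ((hI.reg_subset _).trans hst)) (Set.toFinite _)
  | scanWrite s i h hph hi => exact quiet _ (Function.update_self ..) (by simp [LocalState.absorb])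
  | checkMiss s j h hph hv => exact quiet _ (Function.update_self ..) (by simp [LocalState.absorb])
  | checkNext s j h hph hv hj =>
    refine keep ?_ (by simp)
    rintro s' j' h1 h2
    simp only [Function.update_self, ProcState.running.injEq] at h1
    subst h1
    cases h2
    obtain ⟨h1, h2, h3⟩ := hI.check p s j h hph
    refine ⟨h1, h2, h3.imp_left ?_⟩
    rintro ⟨i, hi, h4⟩
    refine ⟨i, ?_, h4⟩
    by_contra h5
    rcases fin_lt_or_eq_of_lt_add_one hj (not_le.1 h5) with h6 | rfl
    · exact absurd hi (not_le.2 h6)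
    · exact h4 hv
  | checkDone s h hph hv =>
    refine keep (by simp) fun x hx => ?_
    simp only [Function.update_self, ProcState.named.injEq] at hx
    obtain ⟨h1, h2, h3⟩ := hI.check p s _ h hph
    refine .inl ⟨s.view, h3.resolve_left ?_, hI.mem_view p s h,
      (hI.view_subset p s h).trans hst, hx.symm⟩
    rintro ⟨i, hi, h4⟩
    obtain rfl := le_antisymm (Fin.le_last i) hi
    exact h4 hv
  | scanCheck s h hph hb hi =>
    set s' := s.absorb (Fin.last b) (C.reg (Fin.last b)) (.check 0) with hs'
    have hview : ∀ i : Fin (b + 1), (i : ℕ) ≤ s'.view.card → (s'.log i).view = s'.view := by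
      intro i h1
      by_contra h2
      exact hi i ⟨h1, h2⟩
    -- The end of the scan is the decisive instant: either the registers agree with the log and the
    -- view joins `L`, or some register differs for good and the check is bound to fail.
    by_cases hall : ∀ i, C.reg i = s'.log i
    · have hreg : ∀ i : Fin (b + 1), (i : ℕ) ≤ s'.view.card → (C.reg i).view = s'.view := by
        intro i h1
        rw [hall i]
        exact hview i h1
      refine ⟨insert s'.view L, reg_subset, reg_stale, mem_view, view_subset, log_stale,
        ?_, ?_, ?_, ?_, ?_⟩
      · intro q t j hq ht
        by_cases hqp : q = p
        · subst hqp
          simp only [Function.update_self, ProcState.running.injEq] at hq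
          subst hq
          exact ⟨hb, hview, .inr (Set.mem_insert _ _)⟩
        · obtain ⟨h1, h2, h3⟩ := check_ne q hqp t j hq ht
          exact ⟨h1, h2, h3.imp_right (Set.mem_insert_of_mem _)⟩
      · intro q x hq
        by_cases hqp : q = p
        · subst hqp
          simp at hq
        · exact (name_ne q hqp x hq).mono subset_rfl (Set.subset_insert _ _)
      · rintro S (rfl | hS)
        · exact hb
        · exact hI.card_le S hS
      · rintro S (rfl | hS) T hT hST
        · refine ⟨∅, ∅, by simp, by simp, fun i h1 _ h2 => hST ?_, by simp⟩
          rwa [← hreg i h1]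
        · exact locked S hS T hT hST
      -- An older view of the same size is locked, so the registers `0, …, S.card` could not all
      -- hold a different new one.
      · have key : ∀ S ∈ L, S.card = s'.view.card → S = s'.view := by
          intro S hS hcard
          by_contra hne
          have h1 : ¬ S ⊆ s'.view := fun h1 => hne (Finset.eq_of_subset_of_card_le h1 hcard.ge)
          obtain ⟨i, h2, h3⟩ := (hI.locked S hS s'.view hcard.ge h1).exists_reg
            (hI.card_le S hS) hcard.ge
          exact h3 (hreg i (h2.trans hcard.le)).subset
        rintro S (rfl | hS) T (rfl | hT) hST
        · rfl
        · exact (key T hT hST.symm).symm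
        · exact key S hS hST
        · exact hI.unique S hS T hT hST
    · refine keep ?_ (by simp)
      rintro t j h1 h2
      simp only [Function.update_self, ProcState.running.injEq] at h1
      subst h1
      cases h2
      rw [not_forall] at hall
      obtain ⟨i, h3⟩ := hall
      exact ⟨hb, hview, .inl ⟨i, Fin.zero_le i, h3⟩⟩

theorem exists_inv_of_reachable {C : (viewAlgorithm n b).Config}
    (hC : (viewAlgorithm n b).Reachable C) : ∃ L, Inv (toConf C) L := by
  obtain ⟨σ, rfl⟩ := hC
  unfold Algorithm.run
  induction σ using List.reverseRecOn with
  | nil => exact ⟨∅, inv_initial⟩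
  | append_singleton σ p ih =>
    obtain ⟨L, hL⟩ := ih
    rw [List.foldl_append, List.foldl_cons, List.foldl_nil]
    by_cases h : ∀ x, ((σ.foldl (viewAlgorithm n b).step (viewAlgorithm n b).initial).proc p)
        ≠ .named x
    · exact (move_step h).exists_inv hL
    · push Not at h
      obtain ⟨x, hx⟩ := h
      rw [Algorithm.step_of_named _ hx]
      exact ⟨L, hL⟩

/-! ### Termination -/

/-- The view of a process, increasing in the course of an execution. -/
def ProcState.view : ProcState (LocalState n b) → Finset (Fin n)
  | .idle => ∅
  | .running s => s.view
  -- The largest value, so that returning a name does not break monotonicity.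
  | .named _ => Finset.univ

theorem Move.ne_named {C C' : Conf n b} {p : Fin n} (h : Move C p C') (x : ℕ) :
    C.proc p ≠ .named x := by
  cases h <;> simp_all

theorem Move.ne_idle {C C' : Conf n b} {p : Fin n} (h : Move C p C') : C'.proc p ≠ .idle := by
  cases h <;> simp

theorem Move.view_mono {C C' : Conf n b} {p : Fin n} (h : Move C p C') (u : Fin n) :
    (C.proc u).view ⊆ (C'.proc u).view := by
  by_cases hu : u = p
  · subst hu
    cases h <;> simp_all [ProcState.view, LocalState.absorb]
  · rw [h.proc_of_ne hu]

/-- An infinite execution in which the processes that take steps have constant views and take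
infinitely many steps. -/
structure Loop (C : ℕ → Conf n b) (P : ℕ → Fin n) (V : Fin n → Finset (Fin n)) : Prop where
  move : ∀ t, Move (C t) (P t) (C (t + 1))
  recur : ∀ t T, ∃ t' ≥ T, P t' = P t
  running : ∀ t t', ∃ s, (C t').proc (P t) = .running s ∧ s.view = V (P t)

/-- An infinite execution contains a loop. -/
theorem exists_loop {C : ℕ → Conf n b} {P : ℕ → Fin n}
    (h : ∀ t, Move (C t) (P t) (C (t + 1))) : ∃ C' P' V, Loop (n := n) (b := b) C' P' V := by
  have hmono : Monotone fun t u => ((C t).proc u).view :=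
    monotone_nat_of_le_succ fun t u => (h t).view_mono u
  -- From `T₁` on all views are constant; from `T₂` on only processes with infinitely many steps
  -- move.
  obtain ⟨T₁, hT₁⟩ := WellFoundedGT.monotone_chain_condition ⟨_, hmono⟩
  have hfin : ∀ᶠ t in Filter.atTop, ∀ u, P t = u → ∃ᶠ t' in Filter.atTop, P t' = u := by
    rw [Filter.eventually_all]
    intro u
    by_cases hu : ∃ᶠ t' in Filter.atTop, P t' = u
    · exact .of_forall fun _ _ => hu
    · exact (Filter.not_frequently.1 hu).mono fun t h1 h2 => absurd h2 h1
  have nonidle : ∀ t t' u, t ≤ t' → (C t).proc u ≠ .idle → (C t').proc u ≠ .idle := by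
    intro t t' u htt hu
    induction t', htt using Nat.le_induction with
    | base => exact hu
    | succ t' _ ih =>
      by_cases hup : u = P t'
      · subst hup
        exact (h t').ne_idle
      · rwa [(h t').proc_of_ne hup]
  have named : ∀ t t' u x, t ≤ t' → (C t).proc u = .named x → (C t').proc u = .named x := by
    intro t t' u x htt hu
    induction t', htt using Nat.le_induction with
    | base => exact hu
    | succ t' _ ih =>
      by_cases hup : u = P t'
      · subst hup
        exact absurd ih ((h t').ne_named x)
      · rwa [(h t').proc_of_ne hup]
  have hrun : ∀ᶠ t in Filter.atTop, ∀ u, (∃ᶠ t' in Filter.atTop, P t' = u) →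
      (C t).proc u ≠ .idle := by
    rw [Filter.eventually_all]
    intro u
    by_cases hu : ∃ᶠ t' in Filter.atTop, P t' = u
    · obtain ⟨t₀, -, ht₀⟩ := Filter.frequently_atTop.1 hu 0
      refine Filter.eventually_atTop.2 ⟨t₀ + 1, fun t ht _ => nonidle _ t u ht ?_⟩
      rw [← ht₀]
      exact (h t₀).ne_idle
    · exact .of_forall fun _ h1 => absurd h1 hu
  obtain ⟨T₂, hT₂⟩ := Filter.eventually_atTop.1 (hfin.and hrun)
  refine ⟨fun t => C (t + max T₁ T₂), fun t => P (t + max T₁ T₂),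
    fun u => ((C T₁).proc u).view, fun t => ?_, fun t T => ?_, fun t t' => ?_⟩
  · have := h (t + max T₁ T₂)
    rwa [add_right_comm] at this
  · have h1 := (hT₂ (t + max T₁ T₂) (by omega)).1 _ rfl
    obtain ⟨t', ht', h2⟩ := Filter.frequently_atTop.1 h1 (T + max T₁ T₂)
    refine ⟨t' - max T₁ T₂, by omega, ?_⟩
    rw [Nat.sub_add_cancel (by omega)]
    exact h2
  · have h1 := (hT₂ (t + max T₁ T₂) (by omega)).1 _ rfl
    have h2 := (hT₂ (t' + max T₁ T₂) (by omega)).2 _ h1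
    have h3 := congrFun (hT₁ (t' + max T₁ T₂) (by omega)) (P (t + max T₁ T₂))
    simp only [OrderHom.coe_mk] at h3
    rcases h4 : (C (t' + max T₁ T₂)).proc (P (t + max T₁ T₂)) with _ | s | x
    · exact absurd h4 h2
    · refine ⟨s, rfl, ?_⟩
      rw [h3, h4]
      rfl
    · obtain ⟨t₃, ht₃, h5⟩ := Filter.frequently_atTop.1 h1 (t' + max T₁ T₂)
      have h6 := named _ t₃ _ x ht₃ h4
      rw [← h5] at h6
      exact absurd h6 ((h t₃).ne_named x)

/-- The steps in a loop. -/
inductive LoopStep (W : Finset (Fin n)) (R : Fin (b + 1) → Cell n) (s s' : LocalState n b) : Prop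
  | write (i : Fin (b + 1)) (hs : s.phase = .write i) (hs' : s'.phase = .scan 0)
  | scanNext (j : Fin (b + 1)) (hs : s.phase = .scan j) (hj : j ≠ Fin.last b)
      (hR : (R j).view ⊆ W) (hs' : s' = s.absorb j (R j) (.scan (j + 1)))
  | scanWrite (i : Fin (b + 1)) (hs : s.phase = .scan (Fin.last b))
      (hR : (R (Fin.last b)).view ⊆ W) (hs' : s' = s.absorb (Fin.last b) (R (Fin.last b)) (.write i))
      (hi : (s'.log i).view ≠ W)
  | scanCheck (hs : s.phase = .scan (Fin.last b))
      (hR : (R (Fin.last b)).view ⊆ W) (hs' : s' = s.absorb (Fin.last b) (R (Fin.last b)) (.check 0))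
  | checkMiss (j : Fin (b + 1)) (hs : s.phase = .check j)
      (hR : (R j).view ⊆ W) (hne : R j ≠ s.log j) (hs' : s'.phase = .scan 0)
  | checkNext (j : Fin (b + 1)) (hs : s.phase = .check j) (hj : j ≠ Fin.last b)
      (hs' : s' = { s with phase := .check (j + 1) })

/-- An upper bound for the number of steps before the next scan begins. -/
def Phase.rank : Phase b → ℕ
  | .write _ => 0
  | .scan j => b + 2 + (b - j)
  | .check j => 1 + (b - j)

theorem fin_sub_add_one_lt {j : Fin (b + 1)} (hj : j ≠ Fin.last b) :
    b - ((j + 1 : Fin (b + 1)) : ℕ) < b - (j : ℕ) := by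
  have hj' : (j : ℕ) < b := Fin.val_lt_last hj
  rw [Fin.val_add_one_of_lt hj']
  omega

/-- Only a write or a failed check restarts the scan, so it remains to exclude these two for some
looping process. -/
theorem LoopStep.rank_lt {W : Finset (Fin n)} {R : Fin (b + 1) → Cell n} {s s' : LocalState n b}
    (h : LoopStep W R s s') : s'.phase.rank < s.phase.rank ∨ s'.phase = .scan 0 ∧
      ((∃ i, s.phase = .write i) ∨ ∃ j, s.phase = .check j ∧ (R j).view ⊆ W ∧ R j ≠ s.log j) := by
  cases h with
  | write i hs hs' => exact .inr ⟨hs', .inl ⟨i, hs⟩⟩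
  | scanNext j hs hj hR hs' =>
    have := fin_sub_add_one_lt hj
    simp only [hs', hs, LocalState.absorb, Phase.rank]
    omega
  | scanWrite i hs hR hs' hi =>
    simp only [hs', hs, LocalState.absorb, Phase.rank]
    omega
  | scanCheck hs hR hs' =>
    simp only [hs', hs, LocalState.absorb, Phase.rank, Fin.val_zero, Fin.val_last]
    omega
  | checkMiss j hs hR hne hs' => exact .inr ⟨hs', .inr ⟨j, hs, hR, hne⟩⟩
  | checkNext j hs hj hs' =>
    have := fin_sub_add_one_lt hj
    simp only [hs', hs, Phase.rank]
    omega

/-! ### Impossibility of loops -/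

namespace Loop

variable {C : ℕ → Conf n b} {P : ℕ → Fin n} {V : Fin n → Finset (Fin n)}

theorem loopStep (h : Loop C P V) {t : ℕ} {s s' : LocalState n b}
    (hs : (C t).proc (P t) = .running s) (hs' : (C (t + 1)).proc (P t) = .running s') :
    LoopStep (V (P t)) (C t).reg s s' := by
  have hV : s'.view = V (P t) := by
    obtain ⟨u, hu, hV⟩ := h.running t (t + 1)
    rw [hs'] at hu
    cases hu
    exact hV
  have hm := h.move t
  have inj : ∀ {u}, (C t).proc (P t) = .running u → u = s := fun hu => by
    rw [hs] at hu
    cases hu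
    rfl
  generalize C (t + 1) = D at *
  cases hm with
  | start hc => simp [hs] at hc
  | scanFull u hc => simp at hs'
  | checkDone u hc => simp at hs'
  | write u i hc hph =>
    obtain rfl := inj hc
    simp only [Function.update_self, ProcState.running.injEq] at hs'
    exact .write i hph (by rw [← hs'])
  | scanNext u j hc hph hj =>
    obtain rfl := inj hc
    simp only [Function.update_self, ProcState.running.injEq] at hs'
    subst hs'
    exact .scanNext j hph hj (hV ▸ Finset.subset_union_right) rfl
  | scanWrite u i hc hph hi =>
    obtain rfl := inj hc
    simp only [Function.update_self, ProcState.running.injEq] at hs'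
    subst hs'
    exact .scanWrite i hph (hV ▸ Finset.subset_union_right) rfl (hV ▸ hi.2)
  | scanCheck u hc hph hb hi =>
    obtain rfl := inj hc
    simp only [Function.update_self, ProcState.running.injEq] at hs'
    subst hs'
    exact .scanCheck hph (hV ▸ Finset.subset_union_right) rfl
  | checkMiss u j hc hph hv =>
    obtain rfl := inj hc
    simp only [Function.update_self, ProcState.running.injEq] at hs'
    subst hs'
    exact .checkMiss j hph (hV ▸ Finset.subset_union_right) hv rfl
  | checkNext u j hc hph hv hj =>
    obtain rfl := inj hc
    simp only [Function.update_self, ProcState.running.injEq] at hs'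
    exact .checkNext j hph hj hs'.symm

/-- The local state of the process `P t₀`. -/
theorem exists_state (h : Loop C P V) (t₀ : ℕ) :
    ∃ σ : ℕ → LocalState n b, (∀ t, (C t).proc (P t₀) = .running (σ t)) ∧
      (∀ t, (σ t).view = V (P t₀)) ∧
      (∀ t, P t = P t₀ → LoopStep (V (P t₀)) (C t).reg (σ t) (σ (t + 1))) ∧
      ∀ t, P t ≠ P t₀ → σ (t + 1) = σ t := by
  choose σ h1 h2 using h.running t₀
  refine ⟨σ, h1, h2, fun t ht => ?_, fun t ht => ?_⟩
  · have := h.loopStep (ht ▸ h1 t) (ht ▸ h1 (t + 1))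
    rwa [ht] at this
  · have := (h.move t).proc_of_ne ht.symm
    rw [h1, h1] at this
    exact ProcState.running.inj this

theorem not_rank_lt (h : Loop C P V) (t₀ : ℕ) {σ : ℕ → LocalState n b}
    (hkeep : ∀ t, P t ≠ P t₀ → σ (t + 1) = σ t) (T : ℕ) :
    ¬ ∀ t ≥ T, P t = P t₀ → (σ (t + 1)).phase.rank < (σ t).phase.rank := by
  intro hlt
  have hanti : ∀ t ≥ T, ∀ t' ≥ t, (σ t').phase.rank ≤ (σ t).phase.rank := by
    intro t ht t' htt
    induction t', htt using Nat.le_induction with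
    | base => exact le_rfl
    | succ t' htt ih =>
      by_cases hp : P t' = P t₀
      · exact (hlt t' (ht.trans htt) hp).le.trans ih
      · rwa [hkeep t' hp]
  have key : ∀ k, ∀ t ≥ T, (σ t).phase.rank ≠ k := by
    intro k
    induction k using Nat.strong_induction_on with
    | _ k ih =>
      rintro t ht rfl
      obtain ⟨t', ht', hp⟩ := h.recur t₀ t
      exact ih _ ((hlt t' (ht.trans ht') hp).trans_le (hanti t ht t' ht')) (t' + 1) (by omega) rfl
  exact key _ T le_rfl rfl

/-- A process in a loop starts scans again and again. -/
theorem exists_scan_zero (h : Loop C P V) (t₀ : ℕ) {σ : ℕ → LocalState n b}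
    (hstep : ∀ t, P t = P t₀ → LoopStep (V (P t₀)) (C t).reg (σ t) (σ (t + 1)))
    (hkeep : ∀ t, P t ≠ P t₀ → σ (t + 1) = σ t) (T : ℕ) : ∃ t ≥ T, (σ t).phase = .scan 0 := by
  by_contra! hne
  exact h.not_rank_lt t₀ hkeep T fun t ht hp =>
    (hstep t hp).rank_lt.resolve_right fun h1 => hne (t + 1) (by omega) h1.1

/-- Register `i` is written in step `t`. -/
def Writes (C : ℕ → Conf n b) (P : ℕ → Fin n) (t : ℕ) (i : Fin (b + 1)) : Prop :=
  ∃ s, (C t).proc (P t) = .running s ∧ s.phase = .write i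

theorem reg_succ (h : Loop C P V) (t : ℕ) (i : Fin (b + 1)) :
    (C (t + 1)).reg i = (C t).reg i ∨
      Writes C P t i ∧ ((C (t + 1)).reg i).view = V (P t) := by
  rcases (h.move t).reg_cases i with h1 | ⟨s, h1, h2, h3⟩
  · exact .inl h1
  · obtain ⟨s', h4, h5⟩ := h.running t t
    rw [h1] at h4
    cases h4
    exact .inr ⟨⟨s, h1, h2⟩, by rw [h3, ← h5]⟩

theorem Writes.view (h : Loop C P V) {t : ℕ} {i : Fin (b + 1)} (hw : Writes C P t i) :
    ((C (t + 1)).reg i).view = V (P t) := by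
  obtain ⟨s, h1, h2⟩ := hw
  obtain ⟨s', h3, h4⟩ := h.running t t
  rw [h1] at h3
  cases h3
  have hm := h.move t
  generalize C (t + 1) = D at *
  cases hm <;> simp_all

/-- Eventually the registers that are written at all contain views of looping processes. -/
theorem eventually_reg (h : Loop C P V) : ∃ T, ∀ t ≥ T, ∀ i,
    (∃ t', Writes C P t' i) → ∃ t', ((C t).reg i).view = V (P t') := by
  have : ∀ᶠ t in Filter.atTop, ∀ i, (∃ t', Writes C P t' i) →
      ∃ t', ((C t).reg i).view = V (P t') := by
    rw [Filter.eventually_all]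
    intro i
    by_cases hw : ∃ t', Writes C P t' i
    · obtain ⟨t₀, hw⟩ := hw
      refine Filter.eventually_atTop.2 ⟨t₀ + 1, fun t ht _ => ?_⟩
      induction t, ht using Nat.le_induction with
      | base => exact ⟨t₀, hw.view h⟩
      | succ t _ ih =>
        rcases h.reg_succ t i with h1 | ⟨-, h1⟩
        · rwa [h1]
        · exact ⟨t, h1⟩
    · exact .of_forall fun _ h1 => absurd h1 hw
  exact Filter.eventually_atTop.1 this

/-- A looping process with a smallest view eventually stops writing. -/
theorem eventually_not_writes (h : Loop C P V) (t₀ : ℕ)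
    (hmin : ∀ t, (V (P t₀)).card ≤ (V (P t)).card) :
    ∃ T, ∀ t ≥ T, P t = P t₀ → ∀ i, ¬ Writes C P t i := by
  obtain ⟨T, hT⟩ := h.eventually_reg
  obtain ⟨σ, hσ, -, hstep, hkeep⟩ := h.exists_state t₀
  obtain ⟨t₁, ht₁, hscan⟩ := h.exists_scan_zero t₀ hstep hkeep T
  -- Registers that the loop never writes may hold foreign contents forever and are exempt. `OK`
  -- then says that a pending write aims at such a register, which is absurd once the write takes
  -- place.
  let Good : Cell n → Fin (b + 1) → Prop := fun v i =>
    (∃ t', Writes C P t' i) → v.view = V (P t₀)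
  let OK : LocalState n b → Prop := fun s =>
    match s.phase with
    | .write i => ∀ t', ¬ Writes C P t' i
    | .scan j => ∀ i < j, Good (s.log i) i
    | .check _ => True
  have hread : ∀ t ≥ t₁, ∀ j, ((C t).reg j).view ⊆ V (P t₀) → Good ((C t).reg j) j := by
    intro t ht j hsub hw
    obtain ⟨t', ht'⟩ := hT t (ht₁.trans ht) j hw
    -- The register holds the view of some looping process, so minimality turns inclusion into
    -- equality.
    exact Finset.eq_of_subset_of_card_le hsub (ht' ▸ hmin t')
  have hupd : ∀ t ≥ t₁, ∀ j, ((C t).reg j).view ⊆ V (P t₀) → ∀ log : Fin (b + 1) → Cell n,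
      (∀ i < j, Good (log i) i) → ∀ i ≤ j, Good (Function.update log j ((C t).reg j) i) i := by
    intro t ht j hsub log hlog i hij
    rcases hij.lt_or_eq with h1 | rfl
    · rw [Function.update_of_ne h1.ne]
      exact hlog i h1
    · rw [Function.update_self]
      exact hread t ht i hsub
  have hOK : ∀ t ≥ t₁, OK (σ t) := by
    intro t ht
    induction t, ht using Nat.le_induction with
    | base => simp [OK, hscan]
    | succ t ht ih =>
      by_cases hp : P t = P t₀
      · cases hstep t hp with
        | write i hs hs' => simp [OK, hs']
        | scanNext j hs hj hR hs' =>
          simp only [OK, hs] at ih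
          simp only [OK, hs', LocalState.absorb]
          intro i hi
          refine hupd t ht j hR _ ih i ?_
          rcases fin_lt_or_eq_of_lt_add_one hj hi with h1 | rfl
          · exact h1.le
          · exact le_rfl
        | scanWrite i hs hR hs' hi =>
          simp only [OK, hs] at ih
          have h1 := hupd t ht _ hR _ ih i (Fin.le_last i)
          rw [hs'] at hi
          have : ¬ ∃ t', Writes C P t' i := fun h2 => hi (h1 h2)
          simpa [OK, hs', LocalState.absorb] using this
        | scanCheck hs hR hs' => simp [OK, hs', LocalState.absorb]
        | checkMiss j hs hR hne hs' => simp [OK, hs']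
        | checkNext j hs hj hs' => simp [OK, hs']
      · rwa [hkeep t hp]
  refine ⟨t₁, fun t ht hp i hw => ?_⟩
  obtain ⟨s, h1, h2⟩ := id hw
  rw [hp, hσ] at h1
  cases h1
  have := hOK t ht
  simp only [OK, h2] at this
  exact this t hw

/-- After all processes with views of minimal size stop writing, every write has a strictly larger
view. A register read by `P t₀` has contents inside its view, so it is unchanged since `T`; checks
cannot fail and the rank would decrease forever. -/
theorem false (h : Loop C P V) : False := by
  obtain ⟨t₀, hmin⟩ : ∃ t₀, ∀ t, (V (P t₀)).card ≤ (V (P t)).card := by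
    let f : ℕ → ℕ := fun t => (V (P t)).card
    exact ⟨Function.argmin f, fun t => Function.argmin_le f t⟩
  have hquiet : ∃ T, ∀ t ≥ T, ∀ i, Writes C P t i → (V (P t₀)).card < (V (P t)).card := by
    have : ∀ᶠ t in Filter.atTop, ∀ u, P t = u → ∀ i, Writes C P t i →
        (V (P t₀)).card < (V (P t)).card := by
      rw [Filter.eventually_all]
      intro u
      -- Every process whose view has the minimal size must be silenced, not only `P t₀`.
      by_cases hu : ∃ t₁, P t₁ = u ∧ (V u).card ≤ (V (P t₀)).card
      · obtain ⟨t₁, rfl, hcard⟩ := hu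
        obtain ⟨T, hT⟩ := h.eventually_not_writes t₁ fun t => hcard.trans (hmin t)
        exact Filter.eventually_atTop.2 ⟨T, fun t ht hp i hw => absurd hw (hT t ht hp i)⟩
      · exact .of_forall fun t hp i _ => not_le.1 fun h1 => hu ⟨t, hp, hp ▸ h1⟩
    obtain ⟨T, hT⟩ := Filter.eventually_atTop.1 this
    exact ⟨T, fun t ht i hw => hT t ht _ rfl i hw⟩
  obtain ⟨T, hT⟩ := hquiet
  obtain ⟨σ, hσ, -, hstep, hkeep⟩ := h.exists_state t₀
  have hreg : ∀ t ≥ T, ∀ i, ((C t).reg i).view ⊆ V (P t₀) → (C t).reg i = (C T).reg i := by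
    intro t ht i
    have : (C t).reg i = (C T).reg i ∨ (V (P t₀)).card < ((C t).reg i).view.card := by
      induction t, ht using Nat.le_induction with
      | base => exact .inl rfl
      | succ t ht ih =>
        rcases h.reg_succ t i with h1 | ⟨h1, h2⟩
        · rwa [h1]
        · rw [h2]
          exact .inr (hT t ht i h1)
    exact fun hsub => this.resolve_right (not_lt.2 (Finset.card_le_card hsub))
  obtain ⟨T', hT'⟩ := h.eventually_not_writes t₀ hmin
  obtain ⟨t₁, ht₁, hscan⟩ := h.exists_scan_zero t₀ hstep hkeep (max T T')
  have hTt : ∀ t ≥ t₁, T ≤ t := fun t ht => (le_max_left _ _).trans (ht₁.trans ht)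
  let OK : LocalState n b → Prop := fun s =>
    match s.phase with
    | .write _ => True
    | .scan j => ∀ i < j, s.log i = (C T).reg i
    | .check _ => ∀ i, s.log i = (C T).reg i
  have hupd : ∀ t ≥ t₁, ∀ j, ((C t).reg j).view ⊆ V (P t₀) → ∀ log : Fin (b + 1) → Cell n,
      (∀ i < j, log i = (C T).reg i) →
        ∀ i ≤ j, Function.update log j ((C t).reg j) i = (C T).reg i := by
    intro t ht j hsub log hlog i hij
    rcases hij.lt_or_eq with h1 | rfl
    · rw [Function.update_of_ne h1.ne]
      exact hlog i h1
    · rw [Function.update_self]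
      exact hreg t (hTt t ht) i hsub
  have hOK : ∀ t ≥ t₁, OK (σ t) := by
    intro t ht
    induction t, ht using Nat.le_induction with
    | base => simp [OK, hscan]
    | succ t ht ih =>
      by_cases hp : P t = P t₀
      · cases hstep t hp with
        | write i hs hs' => simp [OK, hs']
        | scanNext j hs hj hR hs' =>
          simp only [OK, hs] at ih
          simp only [OK, hs', LocalState.absorb]
          intro i hi
          refine hupd t ht j hR _ ih i ?_
          rcases fin_lt_or_eq_of_lt_add_one hj hi with h1 | rfl
          · exact h1.le
          · exact le_rfl
        | scanWrite i hs hR hs' hi => simp [OK, hs', LocalState.absorb]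
        | scanCheck hs hR hs' =>
          simp only [OK, hs] at ih
          simp only [OK, hs', LocalState.absorb]
          exact fun i => hupd t ht _ hR _ ih i (Fin.le_last i)
        | checkMiss j hs hR hne hs' => simp [OK, hs']
        | checkNext j hs hj hs' =>
          simp only [OK, hs] at ih
          simpa only [OK, hs'] using ih
      · rwa [hkeep t hp]
  refine h.not_rank_lt t₀ hkeep t₁ fun t ht hp => (hstep t hp).rank_lt.resolve_right ?_
  rintro ⟨-, ⟨i, hi⟩ | ⟨j, hj, hsub, hne⟩⟩
  · exact hT' t ((le_max_right _ _).trans (ht₁.trans ht)) hp i ⟨σ t, hp ▸ hσ t, hi⟩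
  · have h1 := hOK t ht
    simp only [OK, hj] at h1
    exact hne ((hreg t (hTt t ht) j hsub).trans (h1 j).symm)

end Loop

/-- The algorithm has no infinite executions. -/
theorem wellFounded_step : WellFounded fun D C : (viewAlgorithm n b).Config =>
    ∃ p, (∀ x, C.proc p ≠ .named x) ∧ D = (viewAlgorithm n b).step C p := by
  rw [wellFounded_iff_isEmpty_descending_chain]
  refine ⟨fun ⟨C, hC⟩ => ?_⟩
  choose P h1 h2 using hC
  obtain ⟨C', P', V, hl⟩ := exists_loop (C := fun t => toConf (C t)) (P := P) fun t => by
    rw [h2 t]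
    exact move_step (h1 t)
  exact hl.false

/-! ### Algorithms without infinite executions -/

namespace Algorithm

variable {m : ℕ}

/-- There are no infinite executions. -/
def Terminating (A : Algorithm n m) : Prop :=
  WellFounded fun D C : A.Config => ∃ p, (∀ x, C.proc p ≠ .named x) ∧ D = A.step C p

theorem run_cons (A : Algorithm n m) (C : A.Config) (p : Fin n) (σ : List (Fin n)) :
    A.run C (p :: σ) = A.run (A.step C p) σ := rfl

theorem run_append (A : Algorithm n m) (C : A.Config) (σ τ : List (Fin n)) :
    A.run C (σ ++ τ) = A.run (A.run C σ) τ :=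
  List.foldl_append

theorem Reachable.run {A : Algorithm n m} {C : A.Config} (h : A.Reachable C) (σ : List (Fin n)) :
    A.Reachable (A.run C σ) := by
  obtain ⟨τ, rfl⟩ := h
  exact ⟨τ ++ σ, A.run_append _ _ _⟩

theorem owns_step {A : Algorithm n m} {C : A.Config} {p : Fin n} {x : ℕ} (h : A.Owns C p x)
    (q : Fin n) : A.Owns (A.step C q) p x := by
  by_cases hq : p = q
  · subst hq
    rwa [A.step_of_named h]
  · unfold Owns at h ⊢
    unfold step
    split
    · simpa [Function.update_of_ne hq] using h
    · split <;> simpa [Function.update_of_ne hq] using h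
    · exact h

theorem owns_run {A : Algorithm n m} {C : A.Config} {p : Fin n} {x : ℕ} (h : A.Owns C p x)
    (σ : List (Fin n)) : A.Owns (A.run C σ) p x := by
  induction σ generalizing C with
  | nil => exact h
  | cons q σ ih => exact ih (owns_step h q)

/-- By induction on the configuration: there are finitely many successors, so their bounds have a
maximum. Steps of named processes change nothing and are dropped from the schedule. -/
theorem Terminating.waitFree {A : Algorithm n m} (h : A.Terminating) : A.WaitFree := by
  intro C hC p
  clear hC
  induction C using h.induction with
  | _ C ih =>
    by_cases hp : ∃ x, C.proc p = .named x
    · obtain ⟨x, hx⟩ := hp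
      exact ⟨0, fun σ _ => ⟨x, owns_run hx σ⟩⟩
    have : ∀ q, ∃ N : ℕ, (∀ x, C.proc q ≠ .named x) →
        ∀ σ : List (Fin n), N ≤ σ.count p → ∃ x, A.Owns (A.run (A.step C q) σ) p x := by
      intro q
      by_cases hq : ∀ x, C.proc q ≠ .named x
      · obtain ⟨N, hN⟩ := ih _ ⟨q, hq, rfl⟩
        exact ⟨N, fun _ => hN⟩
      · exact ⟨0, fun h1 => absurd h1 hq⟩
    choose N hN using this
    refine ⟨Finset.univ.sup N + 1, fun σ hσ => ?_⟩
    induction σ with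
    | nil => simp at hσ
    | cons q σ ihσ =>
      rw [run_cons]
      by_cases hq : ∀ x, C.proc q ≠ .named x
      · refine hN q hq σ ?_
        have h1 : N q ≤ Finset.univ.sup N := Finset.le_sup (Finset.mem_univ q)
        have h2 : (q :: σ).count p ≤ σ.count p + 1 := by
          rw [List.count_cons]
          split_ifs <;> omega
        omega
      · push Not at hq
        obtain ⟨x, hx⟩ := hq
        rw [A.step_of_named hx]
        apply ihσ
        rwa [List.count_cons_of_ne] at hσ
        rintro rfl
        exact hp ⟨x, hx⟩

/-- König's lemma in inductive form: the execution tree is well-founded and finitely branching. -/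
theorem Terminating.finite_run {A : Algorithm n m} (h : A.Terminating) (C : A.Config) :
    (Set.range (A.run C)).Finite := by
  induction C using h.induction with
  | _ C ih =>
    have : (⋃ q : {q // ∀ x, C.proc q ≠ .named x}, Set.range (A.run (A.step C q))).Finite :=
      Set.finite_iUnion fun q => ih _ ⟨q, q.2, rfl⟩
    refine (this.insert C).subset ?_
    rintro _ ⟨σ, rfl⟩
    induction σ with
    | nil => exact Set.mem_insert _ _
    | cons q σ ihσ =>
      rw [run_cons]
      by_cases hq : ∀ x, C.proc q ≠ .named x
      · exact .inr (Set.mem_iUnion.2 ⟨⟨q, hq⟩, σ, rfl⟩)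
      · push Not at hq
        obtain ⟨x, hx⟩ := hq
        rw [A.step_of_named hx]
        exact ihσ

/-! ### Restriction to the values that occur -/

/-- The values that registers contain in reachable configurations. -/
def reachableValues (A : Algorithm n m) : Set A.Value :=
  {v | ∃ C r, A.Reachable C ∧ C.reg r = v}

theorem Terminating.finite_reachableValues {A : Algorithm n m} (h : A.Terminating) :
    A.reachableValues.Finite := by
  have : (⋃ C ∈ Set.range (A.run A.initial), Set.range C.reg).Finite :=
    (h.finite_run _).biUnion fun C _ => Set.finite_range _
  refine this.subset ?_
  rintro v ⟨C, r, hC, rfl⟩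
  exact Set.mem_biUnion hC ⟨r, rfl⟩

open Classical in
/-- The algorithm with registers that can only store the values that occur. -/
noncomputable def restrict (A : Algorithm n m) : Algorithm n m where
  Value := A.reachableValues
  State := A.State
  initValue := fun r => ⟨A.initValue r, A.initial, r, ⟨[], rfl⟩, rfl⟩
  invoke := A.invoke
  access := fun p s =>
    match A.access p s with
    | .read r next => .read r fun v => next v.1
    -- The default value is never used by a step from a reachable configuration, since the written
    -- value then occurs.
    | .write r v next => .write r
        (if h : v ∈ A.reachableValues then ⟨v, h⟩
          else ⟨A.initValue r, A.initial, r, ⟨[], rfl⟩, rfl⟩) next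

/-- A configuration of the restricted algorithm as a configuration of the original one. -/
def unrestrict {A : Algorithm n m} (C : A.restrict.Config) : A.Config where
  proc := C.proc
  reg := fun r => (C.reg r).1

theorem unrestrict_step {A : Algorithm n m} {C : A.restrict.Config}
    (hC : A.Reachable (unrestrict C)) (p : Fin n) :
    unrestrict (A.restrict.step C p) = A.step (unrestrict C) p := by
  rcases hp : C.proc p with _ | s | x
  · have hp' : (unrestrict C).proc p = .idle := hp
    simp only [step, hp, hp']
    rfl
  · have hp' : (unrestrict C).proc p = .running s := hp
    rcases ha : A.access p s with ⟨r, next⟩ | ⟨r, v, next⟩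
    · simp only [step, hp, hp', restrict, ha]
      rfl
    · have hs : A.step (unrestrict C) p =
          ⟨Function.update C.proc p next.toProcState, Function.update (unrestrict C).reg r v⟩ := by
        simp only [step, hp', ha]
        rfl
      have hv : v ∈ A.reachableValues :=
        ⟨A.step (unrestrict C) p, r, hC.run [p], by rw [hs]; exact Function.update_self ..⟩
      have hs' : A.restrict.step C p = ⟨Function.update C.proc p next.toProcState,
          Function.update C.reg r ⟨v, hv⟩⟩ := by
        simp only [step, hp, restrict, ha, dif_pos hv]
      rw [hs, hs']
      have hreg := Function.comp_update (Subtype.val : A.reachableValues → A.Value) C.reg r ⟨v, hv⟩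
      exact congrArg (Config.mk _) hreg
  · have hp' : (unrestrict C).proc p = .named x := hp
    rw [step_of_named _ hp, step_of_named _ hp']

theorem unrestrict_run {A : Algorithm n m} {C : A.restrict.Config}
    (hC : A.Reachable (unrestrict C)) (σ : List (Fin n)) :
    unrestrict (A.restrict.run C σ) = A.run (unrestrict C) σ := by
  induction σ generalizing C with
  | nil => rfl
  | cons p σ ih =>
    have h1 := unrestrict_step hC p
    have h2 : A.Reachable (unrestrict (A.restrict.step C p)) := h1 ▸ hC.run [p]
    rw [run_cons, run_cons, ih h2, h1]

theorem reachable_unrestrict {A : Algorithm n m} {C : A.restrict.Config}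
    (hC : A.restrict.Reachable C) : A.Reachable (unrestrict C) := by
  obtain ⟨σ, rfl⟩ := hC
  have h : A.Reachable (unrestrict A.restrict.initial) := ⟨[], rfl⟩
  rw [unrestrict_run h]
  exact h.run σ

theorem Terminating.boundedRegisters_restrict {A : Algorithm n m} (h : A.Terminating) :
    A.restrict.BoundedRegisters :=
  h.finite_reachableValues.to_subtype

theorem WaitFree.restrict {A : Algorithm n m} (h : A.WaitFree) : A.restrict.WaitFree := by
  intro C hC p
  have hC' := reachable_unrestrict hC
  obtain ⟨N, hN⟩ := h _ hC' p
  refine ⟨N, fun σ hσ => ?_⟩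
  obtain ⟨x, hx⟩ := hN σ hσ
  rw [← unrestrict_run hC'] at hx
  exact ⟨x, hx⟩

theorem IsAdaptiveRenaming.restrict {A : Algorithm n m} {f : ℕ → ℝ}
    (h : A.IsAdaptiveRenaming f) : A.restrict.IsAdaptiveRenaming f := by
  refine ⟨fun C hC p q x hp hq => h.1 _ (reachable_unrestrict hC) p q x hp hq,
    fun C hC p x hp hx hk => ?_⟩
  have hC' := reachable_unrestrict hC
  have h1 := unrestrict_step hC' p
  have := h.2 _ hC' p x hp (h1 ▸ hx)
  rw [← h1] at this
  exact this hk

end Algorithm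

/-! ### Names -/

theorem card_filter_le_pos {S : Finset (Fin n)} {p : Fin n} (hp : p ∈ S) :
    0 < (S.filter (· ≤ p)).card :=
  Finset.card_pos.2 ⟨p, by simp [hp]⟩

/-- Members of a view of size `c` get names above `c.choose 2` and at most `(c + 1).choose 2`, so
different sizes use disjoint blocks. -/
theorem nameIn_le (S : Finset (Fin n)) (p : Fin n) : nameIn S p ≤ (S.card + 1).choose 2 := by
  have h1 : (S.filter (· ≤ p)).card ≤ S.card := Finset.card_filter_le _ _
  have h2 : (S.card + 1).choose 2 = S.card + S.card.choose 2 := by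
    rw [Nat.choose_succ_succ' S.card 1, Nat.choose_one_right]
  unfold nameIn
  omega

theorem nameIn_lt {S T : Finset (Fin n)} {p q : Fin n} (hq : q ∈ T) (h : S.card < T.card) :
    nameIn S p < nameIn T q := by
  have h1 := nameIn_le S p
  have h2 : (S.card + 1).choose 2 ≤ T.card.choose 2 := Nat.choose_le_choose 2 h
  have h3 := card_filter_le_pos hq
  unfold nameIn at h1 ⊢
  omega

theorem nameIn_lt_nameIn {S : Finset (Fin n)} {p q : Fin n} (hq : q ∈ S) (h : p < q) :
    nameIn S p < nameIn S q := by
  refine Nat.add_lt_add_left (Finset.card_lt_card ?_) _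
  rw [Finset.ssubset_iff_of_subset]
  · exact ⟨q, by simp [hq], by simp [h]⟩
  · intro x hx
    rw [Finset.mem_filter] at hx ⊢
    exact ⟨hx.1, hx.2.trans h.le⟩

theorem nameIn_lt_backupName {S : Finset (Fin n)} {p q : Fin n} (h : S.card ≤ b) :
    nameIn S p < backupName b q := by
  have h1 := nameIn_le S p
  have h2 : (S.card + 1).choose 2 ≤ (b + 1).choose 2 := Nat.choose_le_choose 2 (by omega)
  unfold backupName
  omega

theorem Inv.eq_of_name {C : Conf n b} {L : Set (Finset (Fin n))} (h : Inv C L) {p q : Fin n}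
    {x : ℕ} (hp : C.proc p = .named x) (hq : C.proc q = .named x) : p = q := by
  rcases h.name p x hp with ⟨S, hS, hpS, -, hx⟩ | ⟨-, hx⟩ <;>
    rcases h.name q x hq with ⟨T, hT, hqT, -, hy⟩ | ⟨-, hy⟩ <;> subst hx
  · rcases lt_trichotomy S.card T.card with h1 | h1 | h1
    · exact absurd hy (nameIn_lt hqT h1).ne
    · obtain rfl := h.unique S hS T hT h1
      rcases lt_trichotomy p q with h2 | h2 | h2
      · exact absurd hy (nameIn_lt_nameIn hqT h2).ne
      · exact h2
      · exact absurd hy (nameIn_lt_nameIn hpS h2).ne'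
    · exact absurd hy (nameIn_lt hpS h1).ne'
  · exact absurd hy (nameIn_lt_backupName (h.card_le S hS)).ne
  · exact absurd hy (nameIn_lt_backupName (h.card_le T hT)).ne'
  · unfold backupName at hy
    exact Fin.ext (by omega)

theorem Inv.name_bounds {C : Conf n b} {L : Set (Finset (Fin n))} (h : Inv C L)
    (hn : n ≤ b ^ 2) {p : Fin n} {x : ℕ} (hp : C.proc p = .named x) :
    1 ≤ x ∧ (x : ℝ) ≤ 3 * ((started C).ncard : ℝ) ^ 2 / 2 := by
  set k := (started C).ncard with hk
  rcases h.name p x hp with ⟨S, hS, hpS, hsub, rfl⟩ | ⟨hb, rfl⟩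
  · refine ⟨?_, ?_⟩
    · have := card_filter_le_pos hpS
      unfold nameIn
      omega
    · have h1 : S.card ≤ k := by
        rw [← Set.ncard_coe_finset]
        exact Set.ncard_le_ncard hsub (Set.toFinite _)
      have h2 : ((nameIn S p : ℕ) : ℝ) ≤ ((k + 1).choose 2 : ℕ) :=
        Nat.cast_le.2 ((nameIn_le S p).trans (Nat.choose_le_choose 2 (by omega)))
      have h3 : (k : ℝ) ≤ (k : ℝ) ^ 2 := by exact_mod_cast Nat.le_self_pow two_ne_zero k
      rw [Nat.cast_choose_two] at h2
      push_cast at h2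
      linarith
  · refine ⟨by unfold backupName; omega, ?_⟩
    -- The constant `3 / 2` arises here: about `b ^ 2 / 2` names are reserved for views and `n ≤ b ^
    -- 2` for identifiers, while `b + 1 ≤ k`.
    have h1 : backupName b p ≤ (b + 1).choose 2 + b ^ 2 := by
      unfold backupName
      have := p.2
      omega
    have h2 : ((backupName b p : ℕ) : ℝ) ≤ ((b + 1).choose 2 + b ^ 2 : ℕ) := Nat.cast_le.2 h1
    rw [Nat.cast_add, Nat.cast_choose_two] at h2
    push_cast at h2
    have h3 : (b : ℝ) + 1 ≤ k := by exact_mod_cast hb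
    have h4 : (0 : ℝ) ≤ b := Nat.cast_nonneg b
    nlinarith

theorem viewAlgorithm_isAdaptiveRenaming (hn : n ≤ b ^ 2) :
    (viewAlgorithm n b).IsAdaptiveRenaming (fun k : ℕ => 3 * (k : ℝ) ^ 2 / 2) := by
  refine ⟨fun C hC p q x hp hq => ?_, fun C hC p x _ hx _ => ?_⟩
  · obtain ⟨L, hL⟩ := exists_inv_of_reachable hC
    exact hL.eq_of_name hp hq
  · obtain ⟨L, hL⟩ := exists_inv_of_reachable (hC.run [p])
    exact hL.name_bounds hn hx

theorem viewAlgorithm_terminating : (viewAlgorithm n b).Terminating := wellFounded_step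

theorem le_sq_ceil_sqrt (n : ℕ) : n ≤ ⌈Real.sqrt (n : ℝ)⌉₊ ^ 2 := by
  have h := Real.sqrt_le_left (Nat.cast_nonneg _) |>.1 (Nat.le_ceil (Real.sqrt (n : ℝ)))
  exact_mod_cast h

end Renaming

theorem mainTheorem7 (n : ℕ) :
    ∃ A : Renaming.Algorithm n (⌈Real.sqrt (n : ℝ)⌉₊ + 1),
      A.BoundedRegisters ∧ A.WaitFree ∧
        A.IsAdaptiveRenaming (fun k : ℕ => 3 * (k : ℝ) ^ 2 / 2) :=
  ⟨(Renaming.viewAlgorithm n ⌈Real.sqrt (n : ℝ)⌉₊).restrict,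
    Renaming.viewAlgorithm_terminating.boundedRegisters_restrict,
    Renaming.viewAlgorithm_terminating.waitFree.restrict,
    (Renaming.viewAlgorithm_isAdaptiveRenaming (Renaming.le_sq_ceil_sqrt n)).restrict⟩
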